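/- Let $K$ be a number field. For each place $v$ of $K$ let $|\cdot|_v$ be the normalised absolute value (for finite $v$, $|x|_v=N(\mathfrak p_v)^{-\operatorname{ord}_v(x)}$; for infinite $v$, the usual absolute value at a real place and its square at a complex place), and for $P=[x_0:\dots:x_m]\in\mathbf P^m(K)$ put \[H(P)=\prod_v\max_i|x_i|_v ,\] the multiplicative height, not normalised by the degree of $K$. If $L$ is a line in $\mathbf P^n_K$ corresponding to the $2$-dimensional subspace of $K^{n+1}$ spanned by $(a_0,\dots,a_n)$ and $(b_0,\dots,b_n)$, let $H(L)$ be the height of its Plücker point, the point with homogeneous coordinates $a_ib_j-a_jb_i$ for $0\le i<j\le n$. Then there is a real constant $c_K>0$ depending only on $K$ such that for every integer $n\ge 0$, every line $L$ in $\mathbf P^n_K$ and every real number $B$, the set of $K$-rational points $P$ of $L$ with $H(P)\le B$ is finite, and its cardinality $N_L(B)$ satisfies \[N_L(B)\le \frac{c_K}{H(L)}B^2+1 .\] -/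

import Mathlib

open scoped LinearAlgebra.Projectivization

/-- A projective line: a projective subspace whose underlying linear subspace has dimension two. -/
def IsProjLine {K : Type*} [Field K] {n : ℕ} (L : Projectivization.Subspace K (Fin (n + 1) → K)) :
    Prop :=
  Module.finrank K L.submodule = 2

/-- The coordinates `a i * b j - a j * b i`, for `i < j`, of the wedge product of `a` and `b`. -/
def wedgeCoords {K : Type*} [Field K] {n : ℕ} (a b : Fin (n + 1) → K) :
    {p : Fin (n + 1) × Fin (n + 1) // p.1 < p.2} → K :=
  fun p => a p.1.1 * b p.1.2 - a p.1.2 * b p.1.1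

theorem wedgeCoords_ne_zero {K : Type*} [Field K] {n : ℕ} {a b : Fin (n + 1) → K}
    (h : LinearIndependent K ![a, b]) : wedgeCoords a b ≠ 0 := by
  intro h0
  have key : ∀ i j, a i * b j = a j * b i := by
    intro i j
    rcases lt_trichotomy i j with hij | rfl | hij
    · exact sub_eq_zero.mp (congrFun h0 ⟨(i, j), hij⟩)
    · rfl
    · exact (sub_eq_zero.mp (congrFun h0 ⟨(j, i), hij⟩)).symm
  have hp := LinearIndependent.pair_iff.mp h
  have ha : a ≠ 0 := by
    rintro rfl
    exact one_ne_zero (hp 1 0 (by simp)).1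
  obtain ⟨i, hi⟩ := Function.ne_iff.mp ha
  refine hi (hp (-b i) (a i) ?_).2
  funext j
  simp only [Pi.add_apply, Pi.smul_apply, smul_eq_mul, Pi.zero_apply]
  linear_combination key i j

/-- The Plücker point of the line spanned by two linearly independent vectors. -/
noncomputable def pluckerPoint {K : Type*} [Field K] {n : ℕ} (a b : Fin (n + 1) → K)
    (h : LinearIndependent K ![a, b]) : ℙ K ({p : Fin (n + 1) × Fin (n + 1) // p.1 < p.2} → K) :=
  Projectivization.mk K (wedgeCoords a b) (wedgeCoords_ne_zero h)

theorem pluckerPoint_eq_of_span_eq {K : Type*} [Field K] {n : ℕ} {x y a b : Fin (n + 1) → K}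
    (h' : LinearIndependent K ![x, y]) (h : LinearIndependent K ![a, b])
    (hspan : Submodule.span K {x, y} = Submodule.span K {a, b}) :
    pluckerPoint x y h' = pluckerPoint a b h := by
  have hx : x ∈ Submodule.span K {a, b} := hspan ▸ Submodule.subset_span (by simp)
  have hy : y ∈ Submodule.span K {a, b} := hspan ▸ Submodule.subset_span (by simp)
  obtain ⟨p, q, rfl⟩ := Submodule.mem_span_pair.mp hx
  obtain ⟨r, s, rfl⟩ := Submodule.mem_span_pair.mp hy
  unfold pluckerPoint
  rw [Projectivization.mk_eq_mk_iff']
  refine ⟨p * s - q * r, ?_⟩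
  funext i
  simp only [wedgeCoords, Pi.add_apply, Pi.smul_apply, smul_eq_mul]
  ring

theorem IsProjLine.exists_span {K : Type*} [Field K] {n : ℕ}
    {L : Projectivization.Subspace K (Fin (n + 1) → K)} (hL : IsProjLine L) :
    ∃ v : (Fin (n + 1) → K) × (Fin (n + 1) → K),
      LinearIndependent K ![v.1, v.2] ∧ Submodule.span K {v.1, v.2} = L.submodule := by
  let e := Module.finBasisOfFinrankEq K L.submodule hL
  have he : (![(e 0 : Fin (n + 1) → K), (e 1 : Fin (n + 1) → K)]) = L.submodule.subtype ∘ e := by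
    funext i
    fin_cases i <;> rfl
  refine ⟨((e 0 : Fin (n + 1) → K), (e 1 : Fin (n + 1) → K)), ?_, ?_⟩
  · simp only [he]
    exact e.linearIndependent.map' _ (Submodule.ker_subtype _)
  · have h1 : ({(e 0 : Fin (n + 1) → K), (e 1 : Fin (n + 1) → K)} : Set (Fin (n + 1) → K)) =
        L.submodule.subtype '' Set.range e := by
      rw [← Set.range_comp, ← he, Matrix.range_cons, Matrix.range_cons, Matrix.range_empty,
        Set.union_empty]
      rfl
    simp only [h1]
    rw [Submodule.span_image, e.span_eq, Submodule.map_top, Submodule.range_subtype]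

/-- The Plücker point of a projective line, computed from a chosen pair of spanning vectors;
by `IsProjLine.plucker_eq` it does not depend on the choice. -/
noncomputable def IsProjLine.plucker {K : Type*} [Field K] {n : ℕ}
    {L : Projectivization.Subspace K (Fin (n + 1) → K)} (hL : IsProjLine L) :
    ℙ K ({p : Fin (n + 1) × Fin (n + 1) // p.1 < p.2} → K) :=
  pluckerPoint hL.exists_span.choose.1 hL.exists_span.choose.2 hL.exists_span.choose_spec.1

theorem IsProjLine.plucker_eq {K : Type*} [Field K] {n : ℕ}
    {L : Projectivization.Subspace K (Fin (n + 1) → K)} (hL : IsProjLine L)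
    (a b : Fin (n + 1) → K) (h : LinearIndependent K ![a, b])
    (hspan : Submodule.span K {a, b} = L.submodule) :
    hL.plucker = pluckerPoint a b h :=
  pluckerPoint_eq_of_span_eq _ h (hL.exists_span.choose_spec.2.trans hspan.symm)

/-- The height of a projective line over a number field: the height of its Plücker point.
Mathlib's height is the product over all places of the maximum of the normalised absolute values
of the coordinates, not normalised by the degree of the field. -/
noncomputable def IsProjLine.height {K : Type*} [Field K] [NumberField K] {n : ℕ}
    {L : Projectivization.Subspace K (Fin (n + 1) → K)} (hL : IsProjLine L) : ℝ :=
  hL.plucker.mulHeight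

/-- The rational points of height at most `B` on a projective subspace. -/
def pointsOfHeightLE {K : Type*} [Field K] [NumberField K] {n : ℕ}
    (L : Projectivization.Subspace K (Fin (n + 1) → K)) (B : ℝ) : Set (ℙ K (Fin (n + 1) → K)) :=
  {P | P ∈ L ∧ P.mulHeight ≤ B}

/-- The counting function of a projective subspace. -/
noncomputable def pointCount {K : Type*} [Field K] [NumberField K] {n : ℕ}
    (L : Projectivization.Subspace K (Fin (n + 1) → K)) (B : ℝ) : ℕ :=
  (pointsOfHeightLE L B).ncard

/-! Representatives `x`, `y` of two distinct points of `L` span it, so H(L) is the height of x ∧ y.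
Locally, |x ∧ y| is at most |x||y| times a projective distance. That distance is at most 1 at finite
places by the ultrametric inequality, so H(L) ≤ H(x)H(y) times the distances at infinite places
(`mulHeight_wedgeCoords_le`). Now apply pigeonhole. Cut `L` at each infinite place into classes of
diameter at most 2/M (`exists_line_colouring`). With d = [K:ℚ], two points sharing all classes would
give H(L) ≤ (2/M)^d B². Taking M^d just above 2^d B²/H(L) forbids this, so the number of points is
at most the number of classes, (6M)^d. If 2^d B² < H(L), the trivial distance bound 2 leaves at most
one point, whence the +1. -/

open NumberField Height

/-! ### Colourings at infinite places -/

/-- At an infinite place, the unit disc splits into at most `(3 * M) ^ v.mult` cells of diameter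
at most `2 / M`. -/
theorem exists_disc_colouring {K : Type*} [Field K] (v : InfinitePlace K)
    {M : ℕ} (hM : 0 < M) :
    ∃ (κ : Type) (_ : Fintype κ) (g : K → κ), Fintype.card κ ≤ (3 * M) ^ v.mult ∧
      ∀ s t, v s ≤ 1 → v t ≤ 1 → g s = g t → v (s - t) ≤ 2 / M := by
  have hM' : (0 : ℝ) < M := mod_cast hM
  have floor_lt : ∀ r : ℝ, |r| ≤ 1 → ⌊(r + 1) * M⌋₊ < 3 * M := by
    intro r hr
    have h := abs_le.mp hr
    rw [Nat.floor_lt (by nlinarith)]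
    push_cast
    nlinarith
  have floor_close : ∀ r s : ℝ, |r| ≤ 1 → |s| ≤ 1 → ⌊(r + 1) * M⌋₊ = ⌊(s + 1) * M⌋₊ →
      |r - s| ≤ 1 / M := by
    intro r s hr hs h
    have hr' := abs_le.mp hr
    have hs' := abs_le.mp hs
    have h1 := Nat.floor_le (show 0 ≤ (r + 1) * M by nlinarith)
    have h2 := Nat.lt_floor_add_one ((r + 1) * M)
    have h3 := Nat.floor_le (show 0 ≤ (s + 1) * M by nlinarith)
    have h4 := Nat.lt_floor_add_one ((s + 1) * M)
    rw [h] at h1 h2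
    rw [abs_le, ← neg_div, le_div_iff₀ hM', div_le_iff₀ hM']
    constructor <;> nlinarith
  -- The scaled value lies in [0, 2M], so its floor is below 3M, even at the endpoint. The value 0
  -- outside [-1, 1] is never used.
  let q : ℝ → Fin (3 * M) := fun r =>
    if h : |r| ≤ 1 then ⟨⌊(r + 1) * M⌋₊, floor_lt r h⟩ else ⟨0, by lia⟩
  have q_close : ∀ r s : ℝ, |r| ≤ 1 → |s| ≤ 1 → q r = q s → |r - s| ≤ 1 / M := by
    intro r s hr hs h
    simp only [q, hr, hs, dite_true, Fin.mk.injEq] at h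
    exact floor_close r s hr hs h
  have two_div : (2 : ℝ) / M = 1 / M + 1 / M := by ring
  have hre : ∀ s, v s ≤ 1 → |(v.embedding s).re| ≤ 1 := fun s hs =>
    (Complex.abs_re_le_norm _).trans (by rwa [InfinitePlace.norm_embedding_eq])
  have him : ∀ s, v s ≤ 1 → |(v.embedding s).im| ≤ 1 := fun s hs =>
    (Complex.abs_im_le_norm _).trans (by rwa [InfinitePlace.norm_embedding_eq])
  by_cases hv : v.IsReal
  · refine ⟨Fin (3 * M), inferInstance, fun s => q (v.embedding s).re, ?_, ?_⟩
    · simp [InfinitePlace.mult, hv]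
    · intro s t hs ht h
      have him0 : (v.embedding (s - t)).im = 0 :=
        Complex.conj_eq_iff_im.mp (RingHom.congr_fun (ComplexEmbedding.isReal_iff.mp
          (InfinitePlace.isReal_iff.mp hv)) (s - t))
      have := q_close _ _ (hre s hs) (hre t ht) h
      rw [← InfinitePlace.norm_embedding_eq]
      refine (Complex.norm_le_abs_re_add_abs_im _).trans ?_
      rw [him0, abs_zero, map_sub, Complex.sub_re, two_div]
      linarith [show 0 ≤ 1 / (M : ℝ) by positivity]
  · refine ⟨Fin (3 * M) × Fin (3 * M), inferInstance,
      fun s => (q (v.embedding s).re, q (v.embedding s).im), ?_, ?_⟩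
    · simp [InfinitePlace.mult, hv, sq]
    · intro s t hs ht h
      obtain ⟨h1, h2⟩ := Prod.mk.inj h
      rw [← InfinitePlace.norm_embedding_eq]
      refine (Complex.norm_le_abs_re_add_abs_im _).trans ?_
      rw [map_sub, Complex.sub_re, Complex.sub_im, two_div]
      exact add_le_add (q_close _ _ (hre s hs) (hre t ht) h1) (q_close _ _ (him s hs) (him t ht) h2)

/-- At an infinite place, the points of a line split into at most `(6 * M) ^ v.mult` classes of
projective diameter at most `2 / M`. -/
theorem exists_line_colouring {K : Type*} [Field K] [NumberField K] (v : InfinitePlace K)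
    {M : ℕ} (hM : 0 < M) {n : ℕ} {a b : Fin (n + 1) → K} (hab : LinearIndependent K ![a, b]) :
    ∃ (κ : Type) (_ : Fintype κ) (f : (Fin (n + 1) → K) → κ),
      Fintype.card κ ≤ (6 * M) ^ v.mult ∧
      ∀ x ∈ Submodule.span K {a, b}, ∀ y ∈ Submodule.span K {a, b}, f x = f y →
        ∀ p, v (wedgeCoords x y p) ≤ 2 / M * ((⨆ i, v (x i)) * ⨆ i, v (y i)) := by
  classical
  obtain ⟨κ, _, g, hcard, hg⟩ := exists_disc_colouring v hM
  have hw := wedgeCoords_ne_zero hab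
  obtain ⟨p₀, hp₀⟩ := Function.ne_iff.mp hw
  have : Nonempty {p : Fin (n + 1) × Fin (n + 1) // p.1 < p.2} := ⟨p₀⟩
  -- All wedges of vectors of the plane are proportional to a ∧ b, so one coordinate pair (i, j) is
  -- dominant for all of them, and colouring by the ratio of these two coordinates suffices.
  obtain ⟨m, hm⟩ := Finite.exists_max fun p => v (wedgeCoords a b p)
  have hm0 : 0 < v (wedgeCoords a b m) :=
    (InfinitePlace.pos_iff.mpr hp₀).trans_le (hm p₀)
  obtain ⟨⟨i, j⟩, hij⟩ := m
  -- Two charts, according to which coordinate is larger, keep the ratio in the unit disc.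
  refine ⟨κ ⊕ κ, inferInstance,
    fun z => if v (z j) ≤ v (z i) then .inl (g (z j / z i)) else .inr (g (z i / z j)), ?_, ?_⟩
  · rw [Fintype.card_sum]
    calc Fintype.card κ + Fintype.card κ ≤ 2 * (3 * M) ^ v.mult := by lia
      _ ≤ 2 ^ v.mult * (3 * M) ^ v.mult := by
          gcongr
          exact Nat.le_self_pow v.mult_ne_zero 2
      _ = (6 * M) ^ v.mult := by rw [← mul_pow]; ring_nf
  · intro x hx y hy hxy p
    have hmax : v (wedgeCoords x y p) ≤ v (x i * y j - x j * y i) := by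
      obtain ⟨c, d, rfl⟩ := Submodule.mem_span_pair.mp hx
      obtain ⟨e, f, rfl⟩ := Submodule.mem_span_pair.mp hy
      have h : ∀ k l, (c • a + d • b) k * (e • a + f • b) l
          - (c • a + d • b) l * (e • a + f • b) k
          = (c * f - d * e) * (a k * b l - a l * b k) := by
        intro k l
        simp only [Pi.add_apply, Pi.smul_apply, smul_eq_mul]
        ring
      rw [wedgeCoords, h, h, map_mul, map_mul]
      exact mul_le_mul_of_nonneg_left (hm p) (apply_nonneg v _)
    refine hmax.trans ?_
    have hle : ∀ (z : Fin (n + 1) → K) k, v (z k) ≤ ⨆ i, v (z i) := fun z k =>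
      Finite.le_ciSup_of_le k le_rfl
    have h2M : (0 : ℝ) ≤ 2 / M := by positivity
    have chart : ∀ k l, v (x l) ≤ v (x k) → v (y l) ≤ v (y k) → g (x l / x k) = g (y l / y k) →
        v (x k * y l - x l * y k) ≤ 2 / M * ((⨆ i, v (x i)) * ⨆ i, v (y i)) := by
      intro k l hxk hyk hgk
      -- If the larger coordinate vanishes, so does the other, and the wedge coordinate is 0.
      have hzero : ∀ {s t : K}, v s ≤ v t → t = 0 → s = 0 := by
        rintro s t h rfl
        exact (map_eq_zero v).mp (le_antisymm (by simpa using h) (apply_nonneg v s))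
      have hnn : 0 ≤ 2 / M * ((⨆ i, v (x i)) * ⨆ i, v (y i)) :=
        mul_nonneg h2M (mul_nonneg ((apply_nonneg v _).trans (hle x k))
          ((apply_nonneg v _).trans (hle y k)))
      by_cases hx0 : x k = 0
      · simpa [hx0, hzero hxk hx0] using hnn
      by_cases hy0 : y k = 0
      · simpa [hy0, hzero hyk hy0] using hnn
      have hdiv : ∀ {s t : K}, v s ≤ v t → v (s / t) ≤ 1 := by
        intro s t h
        rw [map_div₀]
        exact div_le_one_of_le₀ h (apply_nonneg v t)
      have h1 := hg _ _ (hdiv hyk) (hdiv hxk) hgk.symm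
      have h2 : x k * y l - x l * y k = (y l / y k - x l / x k) * (x k * y k) := by
        field_simp
      rw [h2, map_mul, map_mul]
      exact mul_le_mul h1 (mul_le_mul (hle x k) (hle y k) (apply_nonneg v _)
        ((apply_nonneg v _).trans (hle x k))) (mul_nonneg (apply_nonneg v _) (apply_nonneg v _)) h2M
    by_cases hx1 : v (x j) ≤ v (x i) <;> by_cases hy1 : v (y j) ≤ v (y i) <;>
      simp only [hx1, hy1, if_true, if_false, reduceCtorEq, Sum.inl.injEq, Sum.inr.injEq] at hxy
    · exact chart i j hx1 hy1 hxy
    · have := chart j i (not_le.mp hx1).le (not_le.mp hy1).le hxy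
      rwa [← InfinitePlace.norm_embedding_eq, ← norm_neg, ← map_neg, neg_sub,
        InfinitePlace.norm_embedding_eq]

/-! ### Heights of wedge products -/

/-- Zero coordinates do not affect the supremum, and each nonzero one has absolute value 1 at almost
all finite places. -/
theorem hasFiniteMulSupport_iSup_finitePlace {K : Type*} [Field K] [NumberField K] {ι : Type*}
    [Finite ι] {x : ι → K} (hx : x ≠ 0) :
    (fun v : FinitePlace K => ⨆ i, v (x i)).HasFiniteMulSupport := by
  have : Nonempty {j // x j ≠ 0} := nonempty_subtype.mpr (Function.ne_iff.mp hx)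
  have key := Function.HasFiniteMulSupport.iSup fun i : {j // x j ≠ 0} =>
    FinitePlace.hasFiniteMulSupport i.2
  convert! key with v
  obtain ⟨i, hi⟩ := Function.ne_iff.mp hx
  have : Nonempty ι := ⟨i⟩
  refine le_antisymm (ciSup_le fun j => ?_)
    (ciSup_le fun ⟨j, hj⟩ => Finite.le_ciSup_of_le (f := fun i => v (x i)) j le_rfl)
  rcases eq_or_ne (x j) 0 with h | h
  · rw [h, map_zero]
    exact Real.iSup_nonneg fun k => apply_nonneg v _
  · exact Finite.le_ciSup_of_le (f := fun i : {j // x j ≠ 0} => v (x i)) ⟨j, h⟩ le_rfl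

theorem mulHeight_wedgeCoords_le {K : Type*} [Field K] [NumberField K] {n : ℕ}
    {x y : Fin (n + 1) → K} (hxy : LinearIndependent K ![x, y]) (e : InfinitePlace K → ℝ)
    (h : ∀ v p, v (wedgeCoords x y p) ≤ e v * ((⨆ i, v (x i)) * ⨆ i, v (y i))) :
    mulHeight (wedgeCoords x y) ≤
      (∏ v : InfinitePlace K, e v ^ v.mult) * (mulHeight x * mulHeight y) := by
  have hw := wedgeCoords_ne_zero hxy
  have hx : x ≠ 0 := hxy.ne_zero 0
  have hy : y ≠ 0 := hxy.ne_zero 1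
  obtain ⟨p₀, -⟩ := Function.ne_iff.mp hw
  have : Nonempty {p : Fin (n + 1) × Fin (n + 1) // p.1 < p.2} := ⟨p₀⟩
  have hfin : (∏ᶠ v : FinitePlace K, ⨆ p, v (wedgeCoords x y p)) ≤
      (∏ᶠ v : FinitePlace K, ⨆ i, v (x i)) * ∏ᶠ v : FinitePlace K, ⨆ i, v (y i) := by
    have hfx := hasFiniteMulSupport_iSup_finitePlace hx
    have hfy := hasFiniteMulSupport_iSup_finitePlace hy
    rw [← finprod_mul_distrib hfx hfy]
    refine finprod_le_finprod (hasFiniteMulSupport_iSup_finitePlace hw)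
      (fun v => Real.iSup_nonneg fun _ => apply_nonneg v _) (hfx.mul hfy) fun v =>
      ciSup_le fun p => ?_
    have hmul : ∀ k l, v (x k * y l) ≤ (⨆ i, v (x i)) * ⨆ i, v (y i) := fun k l => by
      rw [map_mul]
      exact mul_le_mul (Finite.le_ciSup_of_le (f := fun i => v (x i)) k le_rfl)
        (Finite.le_ciSup_of_le (f := fun i => v (y i)) l le_rfl) (apply_nonneg v _)
        (Real.iSup_nonneg fun _ => apply_nonneg v _)
    rw [wedgeCoords, sub_eq_add_neg]
    refine (FinitePlace.add_le v _ _).trans (max_le (hmul _ _) ?_)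
    rw [map_neg_eq_map]
    exact hmul _ _
  have hinf : (∏ v : InfinitePlace K, (⨆ p, v (wedgeCoords x y p)) ^ v.mult) ≤
      (∏ v : InfinitePlace K, e v ^ v.mult) * ((∏ v : InfinitePlace K, (⨆ i, v (x i)) ^ v.mult) *
        ∏ v : InfinitePlace K, (⨆ i, v (y i)) ^ v.mult) := by
    rw [← Finset.prod_mul_distrib, ← Finset.prod_mul_distrib]
    refine Finset.prod_le_prod (fun v _ => pow_nonneg (Real.iSup_nonneg fun _ => apply_nonneg v _) _)
      fun v _ => ?_
    rw [← mul_pow, ← mul_pow]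
    exact pow_le_pow_left₀ (Real.iSup_nonneg fun _ => apply_nonneg v _) (ciSup_le (h v)) _
  rw [NumberField.mulHeight_eq hw, NumberField.mulHeight_eq hx, NumberField.mulHeight_eq hy]
  refine (mul_le_mul hinf hfin (finprod_nonneg fun v => Real.iSup_nonneg fun _ => apply_nonneg v _)
    ((Finset.prod_nonneg fun v _ => pow_nonneg (Real.iSup_nonneg fun _ => apply_nonneg v _) _).trans
      hinf)).trans_eq (by ring)

/-! ### Two points on a line, and the count -/

theorem linearIndependent_rep_pair {K V : Type*} [Field K] [AddCommGroup V] [Module K V] {P Q : ℙ K V}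
    (h : P ≠ Q) : LinearIndependent K ![P.rep, Q.rep] := by
  refine (LinearIndependent.pair_iff' P.rep_nonzero).mpr fun c hc => h ?_
  rw [← P.mk_rep, ← Q.mk_rep, eq_comm, Projectivization.mk_eq_mk_iff']
  exact ⟨c, hc⟩

theorem IsProjLine.height_eq {K : Type*} [Field K] [NumberField K] {n : ℕ}
    {L : Projectivization.Subspace K (Fin (n + 1) → K)} (hL : IsProjLine L) {x y : Fin (n + 1) → K}
    (hx : x ∈ L.submodule) (hy : y ∈ L.submodule) (hxy : LinearIndependent K ![x, y]) :
    hL.height = mulHeight (wedgeCoords x y) := by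
  have hspan : Submodule.span K {x, y} = L.submodule := by
    have : FiniteDimensional K L.submodule := inferInstance
    refine Submodule.eq_of_le_of_finrank_eq (Submodule.span_le.mpr ?_) ?_
    · rintro z (rfl | rfl)
      exacts [hx, hy]
    · have h := finrank_span_eq_card hxy
      rw [Matrix.range_cons, Matrix.range_cons, Matrix.range_empty, Set.union_empty,
        Set.singleton_union] at h
      rw [h, show Module.finrank K L.submodule = 2 from hL, Fintype.card_fin]
  rw [IsProjLine.height, hL.plucker_eq x y hxy hspan, pluckerPoint, Projectivization.mulHeight_mk]

/-- The gap principle: the local constants `c` multiply to `c ^ d` because the multiplicities of the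
infinite places sum to the degree d. -/
theorem IsProjLine.height_le_of_ne {K : Type*} [Field K] [NumberField K] {n : ℕ}
    {L : Projectivization.Subspace K (Fin (n + 1) → K)} (hL : IsProjLine L) {B : ℝ}
    {P Q : ℙ K (Fin (n + 1) → K)} (hP : P ∈ pointsOfHeightLE L B) (hQ : Q ∈ pointsOfHeightLE L B)
    (hne : P ≠ Q) {c : ℝ} (hc : 0 ≤ c)
    (h : P.rep ∈ L.submodule → Q.rep ∈ L.submodule → ∀ (v : InfinitePlace K) p,
      v (wedgeCoords P.rep Q.rep p) ≤ c * ((⨆ i, v (P.rep i)) * ⨆ i, v (Q.rep i))) :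
    hL.height ≤ c ^ Module.finrank ℚ K * B ^ 2 := by
  obtain ⟨hP, hPB⟩ := hP
  obtain ⟨hQ, hQB⟩ := hQ
  have hli := linearIndependent_rep_pair hne
  have hP' : P.rep ∈ L.submodule :=
    (Projectivization.Subspace.mem_submodule_iff L P.rep_nonzero).mpr (by rwa [P.mk_rep])
  have hQ' : Q.rep ∈ L.submodule :=
    (Projectivization.Subspace.mem_submodule_iff L Q.rep_nonzero).mpr (by rwa [Q.mk_rep])
  have hle := mulHeight_wedgeCoords_le hli (fun _ => c) (h hP' hQ')
  rw [← hL.height_eq hP' hQ' hli, Finset.prod_pow_eq_pow_sum, InfinitePlace.sum_mult_eq,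
    ← Projectivization.mulHeight_mk P.rep_nonzero, ← Projectivization.mulHeight_mk Q.rep_nonzero,
    P.mk_rep, Q.mk_rep] at hle
  refine hle.trans (mul_le_mul_of_nonneg_left ?_ (pow_nonneg hc _))
  rw [sq]
  -- Here B ≥ 0 because heights are positive.
  exact mul_le_mul hPB hQB Q.mulHeight_pos.le (P.mulHeight_pos.le.trans hPB)

/-- If `M ^ d` exceeds `2 ^ d * B ^ 2 / H(L)`, then points of height at most `B` of equal colours at
all infinite places coincide, so there are at most `(6 * M) ^ d` of them. -/
theorem pointsOfHeightLE_finite_and_ncard_le {K : Type*} [Field K] [NumberField K] {n : ℕ}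
    {L : Projectivization.Subspace K (Fin (n + 1) → K)} (hL : IsProjLine L) {B : ℝ} {M : ℕ}
    (hM : 0 < M)
    (hMB : 2 ^ Module.finrank ℚ K * B ^ 2 < M ^ Module.finrank ℚ K * hL.height) :
    (pointsOfHeightLE L B).Finite ∧
      (pointsOfHeightLE L B).ncard ≤ (6 * M) ^ Module.finrank ℚ K := by
  classical
  obtain ⟨⟨a, b⟩, hab, hspan⟩ := hL.exists_span
  choose κ _ f hcard hf using fun v : InfinitePlace K => exists_line_colouring v hM hab
  let F : ℙ K (Fin (n + 1) → K) → ∀ v, κ v := fun P v => f v P.rep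
  have hinj : Set.InjOn F (pointsOfHeightLE L B) := by
    intro P hP Q hQ hPQ
    by_contra hne
    have hle := hL.height_le_of_ne hP hQ hne (c := 2 / M) (by positivity) fun hP' hQ' v =>
      hf v _ (hspan ▸ hP') _ (hspan ▸ hQ') (congrFun hPQ v)
    rw [div_pow, div_mul_eq_mul_div, le_div_iff₀ (by positivity)] at hle
    linarith
  refine ⟨Set.Finite.of_finite_image (Set.toFinite _) hinj, ?_⟩
  calc (pointsOfHeightLE L B).ncard = (F '' pointsOfHeightLE L B).ncard := hinj.ncard_image.symm
    _ ≤ Nat.card (∀ v, κ v) := Set.ncard_le_card _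
    _ = ∏ v, Fintype.card (κ v) := by rw [Nat.card_eq_fintype_card, Fintype.card_pi]
    _ ≤ ∏ v : InfinitePlace K, (6 * M) ^ v.mult := Finset.prod_le_prod' fun v _ => hcard v
    _ = (6 * M) ^ Module.finrank ℚ K := by
        rw [Finset.prod_pow_eq_pow_sum, InfinitePlace.sum_mult_eq]

/-- A line of large height has at most one point of height at most `B`. -/
theorem pointsOfHeightLE_subsingleton {K : Type*} [Field K] [NumberField K] {n : ℕ}
    {L : Projectivization.Subspace K (Fin (n + 1) → K)} (hL : IsProjLine L) {B : ℝ}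
    (hB : 2 ^ Module.finrank ℚ K * B ^ 2 < hL.height) : (pointsOfHeightLE L B).Subsingleton := by
  intro P hP Q hQ
  by_contra hne
  refine hB.not_ge (hL.height_le_of_ne hP hQ hne zero_le_two fun _ _ v p => ?_)
  have hmul : ∀ k l, v (P.rep k * Q.rep l) ≤ (⨆ i, v (P.rep i)) * ⨆ i, v (Q.rep i) := fun k l => by
    rw [map_mul]
    exact mul_le_mul (Finite.le_ciSup_of_le (f := fun i => v (P.rep i)) k le_rfl)
      (Finite.le_ciSup_of_le (f := fun i => v (Q.rep i)) l le_rfl) (apply_nonneg v _)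
      (Real.iSup_nonneg fun _ => apply_nonneg v _)
  have h1 := hmul p.1.1 p.1.2
  have h2 := hmul p.1.2 p.1.1
  rw [← InfinitePlace.norm_embedding_eq] at h1 h2
  rw [wedgeCoords, ← InfinitePlace.norm_embedding_eq, map_sub]
  linarith [norm_sub_le (v.embedding (P.rep p.1.1 * Q.rep p.1.2))
    (v.embedding (P.rep p.1.2 * Q.rep p.1.1))]

/-- Take M = ⌊X^(1/d)⌋ + 1; since X ≥ 1, the added 1 at most doubles the root. -/
theorem exists_nat_pow_gt_and_pow_le {d : ℕ} (hd : d ≠ 0) {X : ℝ} (hX : 1 ≤ X) :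
    ∃ M : ℕ, 0 < M ∧ X < (M : ℝ) ^ d ∧ (M : ℝ) ^ d ≤ 2 ^ d * X := by
  have hroot : (X ^ (d : ℝ)⁻¹) ^ d = X := Real.rpow_inv_natCast_pow (by linarith) hd
  have hroot1 : 1 ≤ X ^ (d : ℝ)⁻¹ := Real.one_le_rpow hX (by positivity)
  refine ⟨⌊X ^ (d : ℝ)⁻¹⌋₊ + 1, Nat.succ_pos _, ?_, ?_⟩
  · push_cast
    calc X = (X ^ (d : ℝ)⁻¹) ^ d := hroot.symm
      _ < _ := pow_lt_pow_left₀ (Nat.lt_floor_add_one _) (by linarith) hd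
  · push_cast
    calc ((⌊X ^ (d : ℝ)⁻¹⌋₊ : ℝ) + 1) ^ d ≤ (2 * X ^ (d : ℝ)⁻¹) ^ d :=
          pow_le_pow_left₀ (by positivity)
            (by linarith [Nat.floor_le (show 0 ≤ X ^ (d : ℝ)⁻¹ by linarith)]) _
      _ = 2 ^ d * X := by rw [mul_pow, hroot]

theorem theorem2p1 (K : Type*) [Field K] [NumberField K] :
    ∃ c : ℝ, 0 < c ∧
      ∀ (n : ℕ) (L : Projectivization.Subspace K (Fin (n + 1) → K)) (hL : IsProjLine L) (B : ℝ),
        (pointsOfHeightLE L B).Finite ∧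
          (pointCount L B : ℝ) ≤ c / hL.height * B ^ 2 + 1 := by
  -- 24 = 6 · 2 · 2: the colours, the rounding of M, and the diameter 2/M.
  refine ⟨24 ^ Module.finrank ℚ K, by positivity, fun n L hL B => ?_⟩
  have hH : 0 < hL.height := Projectivization.mulHeight_pos _
  have hnn : 0 ≤ 24 ^ Module.finrank ℚ K / hL.height * B ^ 2 := by positivity
  rcases lt_or_ge (2 ^ Module.finrank ℚ K * B ^ 2) hL.height with hB | hB
  · have hs := pointsOfHeightLE_subsingleton hL hB
    have hcard : (pointCount L B : ℝ) ≤ 1 := by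
      exact_mod_cast (have := hs.finite.to_subtype; Set.ncard_le_one_iff_subsingleton).mpr hs
    exact ⟨hs.finite, by linarith⟩
  · obtain ⟨M, hM, hlt, hle⟩ := exists_nat_pow_gt_and_pow_le
      (Module.finrank_pos (R := ℚ) (M := K)).ne' ((one_le_div hH).mpr hB)
    obtain ⟨hfin, hcard⟩ := pointsOfHeightLE_finite_and_ncard_le hL hM ((div_lt_iff₀ hH).mp hlt)
    refine ⟨hfin, ?_⟩
    calc (pointCount L B : ℝ) ≤ (6 * M) ^ Module.finrank ℚ K := mod_cast hcard
      _ = 6 ^ Module.finrank ℚ K * (M : ℝ) ^ Module.finrank ℚ K := mul_pow _ _ _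
      _ ≤ 6 ^ Module.finrank ℚ K * (2 ^ Module.finrank ℚ K *
            (2 ^ Module.finrank ℚ K * B ^ 2 / hL.height)) := by gcongr
      _ = 24 ^ Module.finrank ℚ K / hL.height * B ^ 2 := by
          rw [show (24 : ℝ) = 6 * (2 * 2) by norm_num, mul_pow, mul_pow]
          ring
      _ ≤ _ := by linarith
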